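/- Let $(\Sigma,\rho)$ be a complete metric space with open balls $B(x,r)=\{y\in\Sigma:\rho(x,y)<r\}$, and let $\mu$ be a nonnegative Borel measure on $\Sigma$ which is doubling, i.e. $0<\mu(B(x,r))<\infty$ and $\mu(B(x,2r))\le C_\mu\,\mu(B(x,r))$ for all $x\in\Sigma$, $r>0$ and some constant $C_\mu<\infty$ (so $(\Sigma,\rho,\mu)$ is a complete space of homogeneous type). Assume that $\mu$ is metrically continuous: $\lim_{y\to x}\mu\big(B(x,r)\,\Delta\,B(y,r)\big)=0$ for all $x\in\Sigma$ and $r>0$. Let $x_0\in\Sigma$, $p\in(1,\infty)$, $p'=\frac{p}{p-1}$, and let $w$ be a weight in the Muckenhoupt class $A_p$ over the metric balls, i.e. $w$ is measurable, $0<w<\infty$ $\mu$-a.e., and $$\sup_{x\in\Sigma,\ r>0}\Big(\frac{1}{\mu(B(x,r))}\int_{B(x,r)}w\,d\mu\Big)\Big(\frac{1}{\mu(B(x,r))}\int_{B(x,r)}w^{1-p'}\,d\mu\Big)^{p-1}<\infty .$$ Let $L^p(\Sigma,w)=L^p(\Sigma,w\,d\mu)$ be the space of (real- or complex-valued) measurable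 functions with $\|f\|_{L^p(\Sigma,w)}=\big(\int_\Sigma|f|^p\,w\,d\mu\big)^{1/p}<\infty$, functions equal a.e. being identified, and write $f_{B(x,r)}=\frac{1}{\mu(B(x,r))}\int_{B(x,r)}f\,d\mu$. Then a subset $\mathcal K\subset L^p(\Sigma,w)$ is relatively compact in $L^p(\Sigma,w)$ if and only if the following three conditions are satisfied: (a) $\displaystyle\sup_{f\in\mathcal K}\|f\|_{L^p(\Sigma,w)}<\infty$; (b) $\displaystyle\lim_{A\to\infty}\sup_{f\in\mathcal K}\|f\,\mathbf 1_{\Sigma\setminus B(x_0,A)}\|_{L^p(\Sigma,w)}=0$; (c) $\displaystyle\lim_{r\to0^+}\sup_{f\in\mathcal K}\|f-f_{B(\cdot,r)}\|_{L^p(\Sigma,w)}=0$. (The suprema over the empty set are $0$.) -/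

import Mathlib

open MeasureTheory Filter Topology Metric
open scoped ENNReal NNReal

/-- A Borel measure `μ` on a metric space is doubling, i.e. `(X, dist, μ)` is a space of homogeneous
type: every ball has positive finite measure, and doubling the radius of a ball increases its
measure by at most a fixed finite factor. -/
structure IsHomogeneousType {X : Type*} [MetricSpace X] [MeasurableSpace X]
    (μ : Measure X) : Prop where
  ball_pos : ∀ (x : X) (r : ℝ), 0 < r → 0 < μ (ball x r)
  ball_lt_top : ∀ (x : X) (r : ℝ), 0 < r → μ (ball x r) < ∞
  doubling : ∃ C : ℝ≥0, ∀ (x : X) (r : ℝ), 0 < r → μ (ball x (2 * r)) ≤ C * μ (ball x r)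

/-- `μ` is metrically continuous: `μ (B(x, r) Δ B(y, r)) → 0` as `y → x`, for all `x` and `r > 0`. -/
def IsMetricallyContinuous {X : Type*} [MetricSpace X] [MeasurableSpace X]
    (μ : Measure X) : Prop :=
  ∀ (x : X) (r : ℝ), 0 < r →
    Tendsto (fun y => μ (symmDiff (ball x r) (ball y r))) (𝓝 x) (𝓝 0)

/-- A weight: a measurable function with `0 < w < ∞` almost everywhere. -/
structure IsWeight {X : Type*} [MeasurableSpace X] (μ : Measure X) (w : X → ℝ≥0∞) : Prop where
  aemeasurable : AEMeasurable w μ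
  pos : ∀ᵐ x ∂μ, 0 < w x
  lt_top : ∀ᵐ x ∂μ, w x < ∞

/-- The `A_p` characteristic of `w` over all metric balls,
`sup_B (⨍_B w dμ) (⨍_B w ^ (1 - p') dμ) ^ (p - 1)`, with `p' = p / (p - 1)`. -/
noncomputable def muckenhouptConst {X : Type*} [MetricSpace X] [MeasurableSpace X]
    (μ : Measure X) (p : ℝ) (w : X → ℝ≥0∞) : ℝ≥0∞ :=
  ⨆ (x : X) (r : ℝ) (_ : 0 < r),
    (⨍⁻ y in ball x r, w y ∂μ) * (⨍⁻ y in ball x r, w y ^ (1 - p / (p - 1)) ∂μ) ^ (p - 1)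

/-- The Muckenhoupt class `A_p` (`1 < p < ∞`) over all metric balls. -/
structure IsMuckenhoupt {X : Type*} [MetricSpace X] [MeasurableSpace X]
    (μ : Measure X) (p : ℝ) (w : X → ℝ≥0∞) : Prop where
  isWeight : IsWeight μ w
  const_lt_top : muckenhouptConst μ p w < ∞

/-! Doubling and completeness make `X` proper, and `Lp` is complete, so relative compactness means
total boundedness. Let σ = w^(1-p') be the dual weight. Hölder gives ∫_E |f| dμ ≤ ‖f‖ σ(E)^(1/p'),
and `A_p` makes w and σ integrable on balls. Two facts about the averages T_r f follow. By
`IsMuckenhoupt.tendsto_ballAverageModulus` they are continuous, with a modulus depending on f only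
through its norm. By `IsMuckenhoupt.exists_lintegral_average_le` the T_r are bounded on L^p(w)
uniformly in r; Hölder and Tonelli suffice, without a maximal function.

Sufficiency is an Arzelà–Ascoli argument: (b) cuts to a ball, (c) replaces f by T_r f, and by (a)
and equicontinuity finitely many values of T_r f determine it up to a small error. For necessity,
the quantities in (b) and (c) tend to 0 for each single f, by density of continuous compactly
supported functions, and are Lipschitz in f uniformly in the parameter, so convergence is uniform on
totally bounded sets (`TotallyBounded.tendsto_iSup`). -/

section

variable {X : Type*} [MeasurableSpace X] {μ : Measure X}

/-- The dual weight `w ^ (1 - p')`. -/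
noncomputable def dualWeight (p : ℝ) (w : X → ℝ≥0∞) (x : X) : ℝ≥0∞ := w x ^ (1 - p / (p - 1))

theorem IsWeight.aemeasurable_dualWeight {w : X → ℝ≥0∞} (hw : IsWeight μ w) (p : ℝ) :
    AEMeasurable (dualWeight p w) μ :=
  hw.aemeasurable.pow_const _

theorem setLIntegral_pos_of_ae_ne_zero {s : Set X} {u : X → ℝ≥0∞} (hu : AEMeasurable u μ)
    (h0 : ∀ᵐ x ∂μ, u x ≠ 0) (hs : μ s ≠ 0) : ∫⁻ x in s, u x ∂μ ≠ 0 := by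
  intro h
  rw [lintegral_eq_zero_iff' hu.restrict] at h
  have : ∀ᵐ x ∂μ.restrict s, False := by
    filter_upwards [h, ae_restrict_of_ae h0] with x h1 h2 using h2 h1
  simp at this
  exact hs this

end

/-! ### Consequences of doubling and of the `A_p` condition on balls -/

section

variable {X : Type*} [MetricSpace X] [MeasurableSpace X] {μ : Measure X}

theorem IsHomogeneousType.exists_pow_le (hμ : IsHomogeneousType μ) :
    ∃ C : ℝ≥0, ∀ (n : ℕ) (x : X) (r : ℝ), 0 < r →
      μ (ball x (2 ^ n * r)) ≤ (C : ℝ≥0∞) ^ n * μ (ball x r) := by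
  obtain ⟨C, hC⟩ := hμ.doubling
  refine ⟨C, fun n x r hr => ?_⟩
  induction n with
  | zero => simp
  | succ n ih =>
    calc μ (ball x (2 ^ (n + 1) * r)) = μ (ball x (2 * (2 ^ n * r))) := by
          rw [pow_succ']; ring_nf
      _ ≤ C * μ (ball x (2 ^ n * r)) := hC _ _ (by positivity)
      _ ≤ C * ((C : ℝ≥0∞) ^ n * μ (ball x r)) := by gcongr
      _ = (C : ℝ≥0∞) ^ (n + 1) * μ (ball x r) := by rw [pow_succ']; ring

/-- Packing: an infinite ε-separated sequence would give disjoint balls of radius ε/2 inside one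
ball of finite measure, while doubling bounds their measures below by a common positive constant. -/
theorem IsHomogeneousType.totallyBounded_closedBall [BorelSpace X] (hμ : IsHomogeneousType μ)
    (x₀ : X) (R : ℝ) : TotallyBounded (closedBall x₀ R) := by
  rw [Metric.totallyBounded_iff]
  by_contra! h
  obtain ⟨ε, hε, h⟩ := h
  obtain ⟨f, hf, hfd⟩ := exists_seq_of_forall_finset_exists (fun x : X => x ∈ closedBall x₀ R)
    (fun x y => ε ≤ dist x y) (fun s _ => by
      obtain ⟨y, hy, hy'⟩ := Set.not_subset.1 (h s s.finite_toSet)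
      refine ⟨y, hy, fun x hx => ?_⟩
      by_contra! hlt
      exact hy' (Set.mem_biUnion (Finset.mem_coe.2 hx) (by rwa [mem_ball, dist_comm])))
  obtain ⟨C, hC⟩ := hμ.exists_pow_le
  -- After n doublings each small ball contains `ball x₀ 1`.
  obtain ⟨n, hn⟩ := pow_unbounded_of_one_lt ((|R| + 1) / (ε / 2)) (one_lt_two (α := ℝ))
  rw [div_lt_iff₀ (by positivity)] at hn
  set c : ℝ≥0∞ := μ (ball x₀ 1) / (C : ℝ≥0∞) ^ n with hc
  have hc0 : 0 < c := ENNReal.div_pos (hμ.ball_pos _ _ one_pos).ne' (by finiteness)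
  have hle : ∀ k, c ≤ μ (ball (f k) (ε / 2)) := fun k => by
    refine ENNReal.div_le_of_le_mul' (le_trans (measure_mono ?_) (hC n (f k) (ε / 2) (by positivity)))
    refine ball_subset_ball' ?_
    have := mem_closedBall'.1 (hf k)
    have := le_abs_self R
    linarith
  have hdis : Pairwise (Function.onFun Disjoint fun k => ball (f k) (ε / 2)) := by
    have aux : ∀ m n, m < n → Disjoint (ball (f m) (ε / 2)) (ball (f n) (ε / 2)) :=
      fun m n hmn => ball_disjoint_ball (by linarith [hfd m n hmn])
    intro m n hmn
    rcases lt_or_gt_of_ne hmn with h | h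
    · exact aux m n h
    · exact (aux n m h).symm
  have hfin := Measure.finite_const_le_meas_of_disjoint_iUnion μ hc0
    (As := fun k => ball (f k) (ε / 2)) (fun _ => measurableSet_ball) hdis (by
      refine ((measure_mono (Set.iUnion_subset fun k => ?_)).trans_lt
        (hμ.ball_lt_top x₀ (|R| + ε) (by positivity))).ne
      refine ball_subset_ball' ?_
      have := mem_closedBall.1 (hf k)
      have := le_abs_self R
      linarith)
  exact Set.infinite_univ (hfin.subset fun k _ => hle k)

theorem IsHomogeneousType.properSpace [CompleteSpace X] [BorelSpace X]
    (hμ : IsHomogeneousType μ) : ProperSpace X :=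
  ⟨fun x r => isCompact_iff_totallyBounded_isComplete.2
    ⟨hμ.totallyBounded_closedBall x r, isClosed_closedBall.isComplete⟩⟩

theorem isLocallyFiniteMeasure_of_ball_lt_top {ν : Measure X}
    (h : ∀ (x : X) (r : ℝ), 0 < r → ν (ball x r) < ∞) : IsLocallyFiniteMeasure ν :=
  ⟨fun x => ⟨ball x 1, ball_mem_nhds x one_pos, h x 1 one_pos⟩⟩

variable {p : ℝ} {w : X → ℝ≥0∞}

theorem IsMuckenhoupt.lintegral_mul_le (hμ : IsHomogeneousType μ) (hp : 1 < p) (x : X) {r : ℝ}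
    (hr : 0 < r) :
    (∫⁻ y in ball x r, w y ∂μ) * (∫⁻ y in ball x r, dualWeight p w y ∂μ) ^ (p - 1) ≤
      muckenhouptConst μ p w * μ (ball x r) ^ p := by
  have h : (⨍⁻ y in ball x r, w y ∂μ) * (⨍⁻ y in ball x r, dualWeight p w y ∂μ) ^ (p - 1) ≤
      muckenhouptConst μ p w := le_iSup_of_le x (le_iSup_of_le r (le_iSup_of_le hr le_rfl))
  rw [setLAverage_eq, setLAverage_eq] at h
  have h0 := (hμ.ball_pos x r hr).ne'
  have h1 := (hμ.ball_lt_top x r hr).ne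
  set m := μ (ball x r)
  set W := ∫⁻ y in ball x r, w y ∂μ
  set S := ∫⁻ y in ball x r, dualWeight p w y ∂μ
  calc W * S ^ (p - 1) = (W / m * (S / m) ^ (p - 1)) * m ^ p := by
        have e1 : m ^ p = m * m ^ (p - 1) := by
          conv_lhs => rw [show p = 1 + (p - 1) by ring]
          rw [ENNReal.rpow_add _ _ h0 h1, ENNReal.rpow_one]
        have e2 : (S / m) ^ (p - 1) * m ^ (p - 1) = S ^ (p - 1) := by
          rw [← ENNReal.mul_rpow_of_nonneg _ _ (by linarith), ENNReal.div_mul_cancel h0 h1]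
        rw [e1]
        calc W * S ^ (p - 1) = (W / m * m) * ((S / m) ^ (p - 1) * m ^ (p - 1)) := by
              rw [e2, ENNReal.div_mul_cancel h0 h1]
          _ = _ := by ring
    _ ≤ _ := by gcongr

/-- The product of the two factors is finite and neither factor is zero, so neither can be infinite.
-/
theorem IsMuckenhoupt.setLIntegral_lt_top (hμ : IsHomogeneousType μ) (hw : IsMuckenhoupt μ p w)
    (hp : 1 < p) (x : X) {r : ℝ} (hr : 0 < r) :
    ∫⁻ y in ball x r, w y ∂μ < ∞ ∧ ∫⁻ y in ball x r, dualWeight p w y ∂μ < ∞ := by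
  have h0 := (hμ.ball_pos x r hr).ne'
  have h := lt_of_le_of_lt (IsMuckenhoupt.lintegral_mul_le (w := w) hμ hp x hr)
    (ENNReal.mul_lt_top hw.const_lt_top
      (ENNReal.rpow_lt_top_of_nonneg (by linarith) (hμ.ball_lt_top x r hr).ne))
  have hW : ∫⁻ y in ball x r, w y ∂μ ≠ 0 := setLIntegral_pos_of_ae_ne_zero
    hw.isWeight.aemeasurable (hw.isWeight.pos.mono fun _ h => h.ne') h0
  have hS : ∫⁻ y in ball x r, dualWeight p w y ∂μ ≠ 0 := by
    refine setLIntegral_pos_of_ae_ne_zero (hw.isWeight.aemeasurable_dualWeight p) ?_ h0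
    filter_upwards [hw.isWeight.pos, hw.isWeight.lt_top] with y h1 h2
    exact (ENNReal.rpow_pos h1 h2.ne).ne'
  constructor
  · refine lt_of_not_ge fun h' => ?_
    rw [top_le_iff.1 h', ENNReal.top_mul] at h
    · exact lt_irrefl _ h
    · simp [ENNReal.rpow_eq_zero_iff, hS, not_lt.2 (sub_pos.2 hp).le]
  · refine lt_of_not_ge fun h' => ?_
    rw [top_le_iff.1 h', ENNReal.top_rpow_of_pos (by linarith), ENNReal.mul_top hW] at h
    exact lt_irrefl _ h

end

/-! ### Weighted Hölder inequality -/

section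

variable {X : Type*} [MeasurableSpace X] {μ : Measure X} {p : ℝ} {w : X → ℝ≥0∞}

/-- Hölder's inequality with respect to a weight and its dual weight. -/
theorem IsWeight.setLIntegral_le (hw : IsWeight μ w) (hp : 1 < p) {g : X → ℝ≥0∞}
    (hg : AEMeasurable g μ) (s : Set X) :
    ∫⁻ x in s, g x ∂μ ≤ (∫⁻ x in s, g x ^ p * w x ∂μ) ^ (1 / p) *
      (∫⁻ x in s, dualWeight p w x ∂μ) ^ (1 - 1 / p) := by
  have hp0 : 0 < p := by linarith
  have hp1 : 0 < p - 1 := by linarith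
  have hpq : p.HolderConjugate (p / (p - 1)) := Real.HolderConjugate.conjExponent hp
  have hq : 1 / (p / (p - 1)) = 1 - 1 / p := by field_simp
  -- Write g = (g w^(1/p)) · w^(-1/p); the p'-th power of the second factor is the dual weight.
  have H := ENNReal.lintegral_mul_le_Lp_mul_Lq (μ.restrict s) hpq
    (f := fun x => g x * w x ^ (1 / p)) (g := fun x => w x ^ (-(1 / p)))
    (hg.mul (hw.aemeasurable.pow_const _)).restrict (hw.aemeasurable.pow_const _).restrict
  rw [hq] at H
  convert H using 1
  · refine lintegral_congr_ae (ae_restrict_of_ae ?_)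
    filter_upwards [hw.pos, hw.lt_top] with x h0 h1
    simp only [Pi.mul_apply]
    rw [mul_assoc, ← ENNReal.rpow_add _ _ h0.ne' h1.ne]
    simp
  · congr 3
    · ext x
      rw [ENNReal.mul_rpow_of_nonneg _ _ hp0.le, ← ENNReal.rpow_mul, one_div_mul_cancel hp0.ne',
        ENNReal.rpow_one]
    · ext x
      rw [dualWeight, ← ENNReal.rpow_mul]
      congr 1
      field_simp
      ring

end

/-! ### Uniform boundedness of the averaging operators -/

section

variable {X : Type*} [MetricSpace X] [MeasurableSpace X] [BorelSpace X]
  {μ : Measure X} {p : ℝ} {w : X → ℝ≥0∞}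

theorem measurable_measure_ball [SecondCountableTopology X] (ν : Measure X) [SFinite ν] (r : ℝ) :
    Measurable fun x => ν (ball x r) := by
  have : MeasurableSet {z : X × X | dist z.2 z.1 < r} :=
    (isOpen_lt (by fun_prop) (by fun_prop)).measurableSet
  exact measurable_measure_prodMk_left this

/-- Averages over balls of a fixed radius are bounded on the weighted `L^p` space, uniformly in the
radius. -/
theorem IsMuckenhoupt.exists_lintegral_average_le [SecondCountableTopology X]
    (hμ : IsHomogeneousType μ) (hw : IsMuckenhoupt μ p w) (hp : 1 < p) :
    ∃ C : ℝ≥0∞, C < ∞ ∧ ∀ r : ℝ, 0 < r → ∀ g : X → ℝ≥0∞, AEMeasurable g μ →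
      ∫⁻ x, ((μ (ball x r))⁻¹ * ∫⁻ y in ball x r, g y ∂μ) ^ p * w x ∂μ ≤
        C * ∫⁻ x, g x ^ p * w x ∂μ := by
  have hp0 : 0 < p := by linarith
  have hp1 : 0 ≤ p - 1 := by linarith
  have := isLocallyFiniteMeasure_of_ball_lt_top hμ.ball_lt_top
  obtain ⟨D, hD⟩ := hμ.exists_pow_le
  refine ⟨((D : ℝ≥0∞) ^ 2) ^ p * muckenhouptConst μ p w, ENNReal.mul_lt_top (by finiteness)
    hw.const_lt_top, fun r hr g hg => ?_⟩
  -- Local finiteness makes the dual measure s-finite, so its mass on `ball x r` is measurable in x.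
  have : IsLocallyFiniteMeasure (μ.withDensity (dualWeight p w)) :=
    isLocallyFiniteMeasure_of_ball_lt_top fun x r hr => by
      rw [withDensity_apply _ measurableSet_ball]
      exact (hw.setLIntegral_lt_top hμ hp x hr).2
  have hS : Measurable fun x => ∫⁻ y in ball x r, dualWeight p w y ∂μ := by
    convert measurable_measure_ball (μ.withDensity (dualWeight p w)) r using 2 with x
    rw [withDensity_apply _ measurableSet_ball]
  have hm := measurable_measure_ball μ r
  set S : X → ℝ≥0∞ := fun x => ∫⁻ y in ball x r, dualWeight p w y ∂μ
  set h : X → ℝ≥0∞ := fun x => ((μ (ball x r))⁻¹) ^ p * S x ^ (p - 1) * w x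
  have hh : AEMeasurable h μ :=
    ((hm.inv.pow_const _).mul (hS.pow_const _)).aemeasurable.mul hw.isWeight.aemeasurable
  set G : X → ℝ≥0∞ := fun y => g y ^ p * w y
  have hG : AEMeasurable G μ := (hg.pow_const _).mul hw.isWeight.aemeasurable
  have hE : MeasurableSet {z : X × X | dist z.2 z.1 < r} :=
    (isOpen_lt (by fun_prop) (by fun_prop)).measurableSet
  -- Hölder on each ball, then Tonelli, leaves the integral of `h` over `ball y r`, which `A_p` on
  -- `ball y (2 * r)` bounds independently of y and r.
  calc ∫⁻ x, ((μ (ball x r))⁻¹ * ∫⁻ y in ball x r, g y ∂μ) ^ p * w x ∂μ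
      ≤ ∫⁻ x, ∫⁻ y, {z : X × X | dist z.2 z.1 < r}.indicator
          (fun z => h z.1 * G z.2) (x, y) ∂μ ∂μ := by
        refine lintegral_mono fun x => ?_
        have e : ∫⁻ y, {z : X × X | dist z.2 z.1 < r}.indicator
            (fun z => h z.1 * G z.2) (x, y) ∂μ = h x * ∫⁻ y in ball x r, G y ∂μ := by
          rw [← lintegral_const_mul'' _ hG.restrict, ← lintegral_indicator measurableSet_ball]
          rfl
        rw [e]
        calc ((μ (ball x r))⁻¹ * ∫⁻ y in ball x r, g y ∂μ) ^ p * w x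
            ≤ ((μ (ball x r))⁻¹ * ((∫⁻ y in ball x r, G y ∂μ) ^ (1 / p) *
                S x ^ (1 - 1 / p))) ^ p * w x := by
              gcongr
              exact hw.isWeight.setLIntegral_le hp hg _
          _ = h x * ∫⁻ y in ball x r, G y ∂μ := by
              rw [ENNReal.mul_rpow_of_nonneg _ _ hp0.le, ENNReal.mul_rpow_of_nonneg _ _ hp0.le,
                ← ENNReal.rpow_mul, ← ENNReal.rpow_mul, one_div_mul_cancel hp0.ne',
                ENNReal.rpow_one, show (1 - 1 / p) * p = p - 1 by field_simp]
              ring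
    _ = ∫⁻ y, ∫⁻ x, {z : X × X | dist z.2 z.1 < r}.indicator
          (fun z => h z.1 * G z.2) (x, y) ∂μ ∂μ := by
        refine lintegral_lintegral_swap ?_
        exact (hh.comp_fst.mul hG.comp_snd).indicator hE
    _ ≤ ∫⁻ y, ((D : ℝ≥0∞) ^ 2) ^ p * muckenhouptConst μ p w * G y ∂μ := by
        refine lintegral_mono fun y => ?_
        have e : ∫⁻ x, {z : X × X | dist z.2 z.1 < r}.indicator
            (fun z => h z.1 * G z.2) (x, y) ∂μ = (∫⁻ x in ball y r, h x ∂μ) * G y := by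
          rw [← lintegral_mul_const'' _ hh.restrict, ← lintegral_indicator measurableSet_ball]
          refine lintegral_congr fun x => ?_
          simp only [Set.indicator, Set.mem_ofPred_eq, mem_ball, dist_comm]
        rw [e]
        gcongr
        have h2r : 0 < 2 * r := by positivity
        set M := μ (ball y (2 * r))
        have hM0 : M ≠ 0 := (hμ.ball_pos y _ h2r).ne'
        have hM1 : M ≠ ∞ := (hμ.ball_lt_top y _ h2r).ne
        set T := ∫⁻ z in ball y (2 * r), dualWeight p w z ∂μ
        calc ∫⁻ x in ball y r, h x ∂μ
            ≤ ∫⁻ x in ball y r, ((D : ℝ≥0∞) ^ 2 * M⁻¹) ^ p * T ^ (p - 1) * w x ∂μ := by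
              refine setLIntegral_mono_ae' measurableSet_ball (ae_of_all _ fun x hx => ?_)
              have hx' := mem_ball.1 hx
              -- `ball y (2 * r)` lies in `ball x (4 * r)`, hence two doublings.
              have h1 : M ≤ (D : ℝ≥0∞) ^ 2 * μ (ball x r) :=
                (measure_mono (ball_subset_ball' (by
                  rw [dist_comm]; linarith))).trans (hD 2 x r hr)
              have h2 : (μ (ball x r))⁻¹ ≤ (D : ℝ≥0∞) ^ 2 * M⁻¹ := by
                rw [ENNReal.inv_le_iff_le_mul (fun _ => (hμ.ball_pos x r hr).ne')
                  (fun h => absurd h (hμ.ball_lt_top x r hr).ne)]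
                rw [mul_left_comm, ← mul_assoc]
                calc (1 : ℝ≥0∞) = M * M⁻¹ := (ENNReal.mul_inv_cancel hM0 hM1).symm
                  _ ≤ _ := by gcongr
              have h3 : S x ≤ T := lintegral_mono_set (ball_subset_ball' (by linarith))
              simp only [h]
              gcongr
          _ = ((D : ℝ≥0∞) ^ 2 * M⁻¹) ^ p * T ^ (p - 1) * ∫⁻ x in ball y r, w x ∂μ := by
              rw [lintegral_const_mul'' _ hw.isWeight.aemeasurable.restrict]
          _ ≤ ((D : ℝ≥0∞) ^ 2 * M⁻¹) ^ p * T ^ (p - 1) * ∫⁻ x in ball y (2 * r), w x ∂μ := by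
              gcongr
              linarith
          _ = ((D : ℝ≥0∞) ^ 2) ^ p * (M⁻¹) ^ p *
                ((∫⁻ x in ball y (2 * r), w x ∂μ) * T ^ (p - 1)) := by
              rw [ENNReal.mul_rpow_of_nonneg _ _ hp0.le]
              ring
          _ ≤ ((D : ℝ≥0∞) ^ 2) ^ p * (M⁻¹) ^ p * (muckenhouptConst μ p w * M ^ p) := by
              exact mul_le_mul' le_rfl (IsMuckenhoupt.lintegral_mul_le hμ hp y h2r)
          _ = ((D : ℝ≥0∞) ^ 2) ^ p * muckenhouptConst μ p w * ((M⁻¹) ^ p * M ^ p) := by ring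
          _ = ((D : ℝ≥0∞) ^ 2) ^ p * muckenhouptConst μ p w := by
              rw [← ENNReal.mul_rpow_of_nonneg _ _ hp0.le, ENNReal.inv_mul_cancel hM0 hM1,
                ENNReal.one_rpow, mul_one]
    _ = _ := by rw [lintegral_const_mul'' _ hG]

end

/-! ### Passage to `eLpNorm` -/

section

variable {𝕜 : Type*} [RCLike 𝕜] {X : Type*} [MeasurableSpace X] {μ : Measure X} {p : ℝ≥0∞}
  {w : X → ℝ≥0∞} {f : X → 𝕜}

/-- Transfers measurability from w dμ back to μ, where the averages are taken. -/
theorem IsWeight.absolutelyContinuous (hw : IsWeight μ w) : μ ≪ μ.withDensity w :=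
  withDensity_absolutelyContinuous' hw.aemeasurable (hw.pos.mono fun _ h => h.ne')

theorem IsWeight.eLpNorm_eq (hw : IsWeight μ w) (hp₁ : 1 < p) (hp : p < ∞)
    (hf : AEStronglyMeasurable f μ) :
    eLpNorm f p (μ.withDensity w) = (∫⁻ x, ‖f x‖ₑ ^ p.toReal * w x ∂μ) ^ (1 / p.toReal) := by
  rw [eLpNorm_eq_lintegral_rpow_enorm_toReal (zero_lt_one.trans hp₁).ne' hp.ne,
    lintegral_withDensity_eq_lintegral_mul₀ hw.aemeasurable (hf.enorm.pow_const _)]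
  simp only [Pi.mul_apply, mul_comm]

theorem one_lt_toReal (hp₁ : 1 < p) (hp : p < ∞) : 1 < p.toReal := by
  rwa [← ENNReal.toReal_one, ENNReal.toReal_lt_toReal (by finiteness) hp.ne]

theorem IsWeight.setLIntegral_enorm_le (hw : IsWeight μ w) (hp₁ : 1 < p) (hp : p < ∞)
    (hf : AEStronglyMeasurable f μ) (s : Set X) :
    ∫⁻ x in s, ‖f x‖ₑ ∂μ ≤ eLpNorm f p (μ.withDensity w) *
      (∫⁻ x in s, dualWeight p.toReal w x ∂μ) ^ (1 - 1 / p.toReal) := by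
  have h1 := one_lt_toReal hp₁ hp
  rw [hw.eLpNorm_eq hp₁ hp hf]
  refine (hw.setLIntegral_le h1 hf.enorm s).trans ?_
  gcongr
  exact Measure.restrict_le_self

end

/-! ### Ball averages and their continuity -/

section

variable {𝕜 : Type*} [RCLike 𝕜] {X : Type*} [MetricSpace X] [MeasurableSpace X]
  {μ : Measure X} {p : ℝ≥0∞} {w : X → ℝ≥0∞} {f g : X → 𝕜}

theorem IsMuckenhoupt.integrableOn_ball (hμ : IsHomogeneousType μ)
    (hw : IsMuckenhoupt μ p.toReal w) (hp₁ : 1 < p) (hp : p < ∞)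
    (hf : MemLp f p (μ.withDensity w)) (x : X) {r : ℝ} (hr : 0 < r) :
    IntegrableOn f (ball x r) μ := by
  have h1 := one_lt_toReal hp₁ hp
  have hfm := hf.1.mono_ac hw.isWeight.absolutelyContinuous
  refine ⟨hfm.restrict, (hw.isWeight.setLIntegral_enorm_le hp₁ hp hfm _).trans_lt ?_⟩
  refine ENNReal.mul_lt_top hf.2 (ENNReal.rpow_lt_top_of_nonneg ?_
    (hw.setLIntegral_lt_top hμ h1 x hr).2.ne)
  have : 1 / p.toReal ≤ 1 := by rw [div_le_one (by linarith)]; exact h1.le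
  linarith

/-- The average of a function over the ball of radius `r`, as a function of the centre. -/
noncomputable def ballAverage (μ : Measure X) (r : ℝ) (f : X → 𝕜) (x : X) : 𝕜 :=
  ⨍ y in ball x r, f y ∂μ

theorem ballAverage_sub {r : ℝ} (hf : ∀ x, IntegrableOn f (ball x r) μ)
    (hg : ∀ x, IntegrableOn g (ball x r) μ) :
    ballAverage μ r (f - g) = ballAverage μ r f - ballAverage μ r g := by
  ext x
  simp only [ballAverage, setAverage_eq, Pi.sub_apply]
  rw [integral_sub (hf x) (hg x), smul_sub]

theorem IsHomogeneousType.enorm_inv_measureReal_ball (hμ : IsHomogeneousType μ) (x : X) {r : ℝ}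
    (hr : 0 < r) : ‖(μ.real (ball x r))⁻¹‖ₑ = (μ (ball x r))⁻¹ := by
  have h0 : μ.real (ball x r) ≠ 0 :=
    (ENNReal.toReal_pos (hμ.ball_pos x r hr).ne' (hμ.ball_lt_top x r hr).ne).ne'
  rw [enorm_inv h0, Real.enorm_of_nonneg measureReal_nonneg,
    ofReal_measureReal (hμ.ball_lt_top x r hr).ne]

theorem IsHomogeneousType.enorm_ballAverage_le (hμ : IsHomogeneousType μ) (f : X → 𝕜) (x : X)
    {r : ℝ} (hr : 0 < r) :
    ‖ballAverage μ r f x‖ₑ ≤ (μ (ball x r))⁻¹ * ∫⁻ y in ball x r, ‖f y‖ₑ ∂μ := by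
  rw [ballAverage, setAverage_eq, enorm_smul, hμ.enorm_inv_measureReal_ball x hr]
  gcongr
  exact enorm_integral_le_lintegral_enorm _

variable [BorelSpace X]

/-- A modulus of continuity for averages over balls of radius `r` of functions in the unit ball of
the weighted `L^p` space. -/
noncomputable def ballAverageModulus (μ : Measure X) (p : ℝ) (w : X → ℝ≥0∞) (r : ℝ) (x y : X) :
    ℝ≥0∞ :=
  ‖(μ.real (ball x r))⁻¹‖ₑ *
      (∫⁻ z in symmDiff (ball x r) (ball y r), dualWeight p w z ∂μ) ^ (1 - 1 / p) +
    ‖(μ.real (ball x r))⁻¹ - (μ.real (ball y r))⁻¹‖ₑ *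
      (∫⁻ z in ball y r, dualWeight p w z ∂μ) ^ (1 - 1 / p)

theorem IsMuckenhoupt.enorm_ballAverage_sub_le (hμ : IsHomogeneousType μ)
    (hw : IsMuckenhoupt μ p.toReal w) (hp₁ : 1 < p) (hp : p < ∞)
    (hf : MemLp f p (μ.withDensity w)) {r : ℝ} (hr : 0 < r) (x y : X) :
    ‖ballAverage μ r f x - ballAverage μ r f y‖ₑ ≤
      eLpNorm f p (μ.withDensity w) * ballAverageModulus μ p.toReal w r x y := by
  have hfm := hf.1.mono_ac hw.isWeight.absolutelyContinuous
  have hint := fun z => hw.integrableOn_ball hμ hp₁ hp hf z hr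
  -- Change the domain of integration first, then the normalisation.
  have e : ballAverage μ r f x - ballAverage μ r f y =
      (μ.real (ball x r))⁻¹ • ((∫ z in ball x r, f z ∂μ) - ∫ z in ball y r, f z ∂μ) +
      ((μ.real (ball x r))⁻¹ - (μ.real (ball y r))⁻¹) • ∫ z in ball y r, f z ∂μ := by
    simp only [ballAverage, setAverage_eq, smul_sub, sub_smul]
    abel
  have h1 : ‖(∫ z in ball x r, f z ∂μ) - ∫ z in ball y r, f z ∂μ‖ₑ ≤
      ∫⁻ z in symmDiff (ball x r) (ball y r), ‖f z‖ₑ ∂μ := by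
    rw [← integral_indicator measurableSet_ball, ← integral_indicator measurableSet_ball,
      ← integral_sub ((hint x).integrable_indicator measurableSet_ball)
        ((hint y).integrable_indicator measurableSet_ball),
      ← lintegral_indicator (measurableSet_ball.symmDiff measurableSet_ball)]
    refine (enorm_integral_le_lintegral_enorm _).trans_eq (lintegral_congr fun z => ?_)
    rw [← Set.apply_indicator_symmDiff enorm_neg, enorm_indicator_eq_indicator_enorm]
  rw [e, ballAverageModulus, mul_add]
  refine (enorm_add_le _ _).trans (add_le_add ?_ ?_)
  · rw [enorm_smul, mul_left_comm]
    gcongr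
    exact h1.trans (hw.isWeight.setLIntegral_enorm_le hp₁ hp hfm _)
  · rw [enorm_smul, mul_left_comm]
    gcongr
    exact (enorm_integral_le_lintegral_enorm _).trans
      (hw.isWeight.setLIntegral_enorm_le hp₁ hp hfm _)

/-- Metric continuity makes the symmetric difference μ-small; absolute continuity of the integral
makes it small for the dual weight too. -/
theorem IsMuckenhoupt.tendsto_ballAverageModulus {p : ℝ} (hμ : IsHomogeneousType μ)
    (hμc : IsMetricallyContinuous μ) (hw : IsMuckenhoupt μ p w) (hp : 1 < p) {r : ℝ} (hr : 0 < r)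
    (x : X) : Tendsto (ballAverageModulus μ p w r x) (𝓝 x) (𝓝 0) := by
  have hθ : 0 < 1 - 1 / p := by
    have : 1 / p < 1 := by rw [div_lt_one (by linarith)]; exact hp
    linarith
  have hfin := (hw.setLIntegral_lt_top hμ hp x (r := 2 * r) (by positivity)).2
  have hsub : ∀ᶠ y in 𝓝 x, ball y r ⊆ ball x (2 * r) := by
    filter_upwards [ball_mem_nhds x hr] with y hy
    exact ball_subset_ball' (by linarith [mem_ball.1 hy])
  have hσ : Tendsto (fun y => ∫⁻ z in symmDiff (ball x r) (ball y r), dualWeight p w z ∂μ)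
      (𝓝 x) (𝓝 0) := by
    -- The restriction to `ball x (2 * r)` supplies the finite integral that absolute continuity
    -- needs.
    have h := tendsto_setLIntegral_zero (μ := μ.restrict (ball x (2 * r))) hfin.ne (l := 𝓝 x)
      (s := fun y => symmDiff (ball x r) (ball y r)) (tendsto_of_tendsto_of_tendsto_of_le_of_le
        tendsto_const_nhds (hμc x r hr) (fun _ => zero_le) fun y => Measure.restrict_apply_le _ _)
    refine h.congr' ?_
    filter_upwards [hsub] with y hy
    rw [Measure.restrict_restrict_of_subset]
    exact Set.symmDiff_subset_union.trans
      (Set.union_subset (ball_subset_ball (by linarith)) hy)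
  have hm : Tendsto (fun y => μ.real (ball y r)) (𝓝 x) (𝓝 (μ.real (ball x r))) := by
    rw [tendsto_iff_dist_tendsto_zero]
    refine squeeze_zero (fun _ => dist_nonneg) (fun y => ?_)
      ((ENNReal.tendsto_toReal ENNReal.zero_ne_top).comp (hμc x r hr))
    rw [dist_comm, Real.dist_eq]
    exact abs_measureReal_sub_le_measureReal_symmDiff' measurableSet_ball.nullMeasurableSet
      measurableSet_ball.nullMeasurableSet (hμ.ball_lt_top x r hr).ne (hμ.ball_lt_top y r hr).ne
  have hm0 : μ.real (ball x r) ≠ 0 :=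
    (ENNReal.toReal_pos (hμ.ball_pos x r hr).ne' (hμ.ball_lt_top x r hr).ne).ne'
  have h1 : Tendsto (fun y => ‖(μ.real (ball x r))⁻¹‖ₑ *
      (∫⁻ z in symmDiff (ball x r) (ball y r), dualWeight p w z ∂μ) ^ (1 - 1 / p)) (𝓝 x) (𝓝 0) := by
    have := ENNReal.Tendsto.const_mul (a := ‖(μ.real (ball x r))⁻¹‖ₑ)
      (hσ.ennrpow_const (1 - 1 / p)) (Or.inr enorm_ne_top)
    rwa [ENNReal.zero_rpow_of_pos hθ, mul_zero] at this
  have h2 : Tendsto (fun y => ‖(μ.real (ball x r))⁻¹ - (μ.real (ball y r))⁻¹‖ₑ *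
      (∫⁻ z in ball x (2 * r), dualWeight p w z ∂μ) ^ (1 - 1 / p)) (𝓝 x) (𝓝 0) := by
    have h3 : Tendsto (fun y => ‖(μ.real (ball x r))⁻¹ - (μ.real (ball y r))⁻¹‖ₑ) (𝓝 x) (𝓝 0) := by
      have := ((hm.inv₀ hm0).const_sub (μ.real (ball x r))⁻¹).enorm
      simpa using this
    have := ENNReal.Tendsto.mul_const h3
      (Or.inr (ENNReal.rpow_lt_top_of_nonneg hθ.le hfin.ne).ne)
    rwa [zero_mul] at this
  have h12 := h1.add h2
  rw [add_zero] at h12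
  refine tendsto_of_tendsto_of_tendsto_of_le_of_le' tendsto_const_nhds h12
    (Eventually.of_forall fun _ => zero_le) ?_
  filter_upwards [hsub] with y hy
  unfold ballAverageModulus
  gcongr

theorem IsMuckenhoupt.continuous_ballAverage (hμ : IsHomogeneousType μ)
    (hμc : IsMetricallyContinuous μ) (hw : IsMuckenhoupt μ p.toReal w) (hp₁ : 1 < p) (hp : p < ∞)
    (hf : MemLp f p (μ.withDensity w)) {r : ℝ} (hr : 0 < r) : Continuous (ballAverage μ r f) := by
  refine continuous_iff_continuousAt.2 fun x => ?_
  rw [ContinuousAt, tendsto_iff_edist_tendsto_0]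
  have h := ENNReal.Tendsto.const_mul (a := eLpNorm f p (μ.withDensity w))
    (hw.tendsto_ballAverageModulus hμ hμc (one_lt_toReal hp₁ hp) hr x) (Or.inr hf.2.ne)
  rw [mul_zero] at h
  refine tendsto_of_tendsto_of_tendsto_of_le_of_le tendsto_const_nhds h (fun _ => zero_le)
    fun y => ?_
  rw [edist_comm, edist_eq_enorm_sub]
  exact hw.enorm_ballAverage_sub_le hμ hp₁ hp hf hr x y

theorem IsMuckenhoupt.exists_eLpNorm_ballAverage_le [SecondCountableTopology X] (𝕜 : Type*)
    [RCLike 𝕜] (hμ : IsHomogeneousType μ) (hμc : IsMetricallyContinuous μ)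
    (hw : IsMuckenhoupt μ p.toReal w) (hp₁ : 1 < p) (hp : p < ∞) :
    ∃ C : ℝ≥0∞, C < ∞ ∧ ∀ r : ℝ, 0 < r → ∀ f : X → 𝕜, MemLp f p (μ.withDensity w) →
      eLpNorm (ballAverage μ r f) p (μ.withDensity w) ≤ C * eLpNorm f p (μ.withDensity w) := by
  have h1 := one_lt_toReal hp₁ hp
  have h0 : 0 ≤ 1 / p.toReal := by positivity
  obtain ⟨C, hC, H⟩ := hw.exists_lintegral_average_le hμ h1
  refine ⟨C ^ (1 / p.toReal), ENNReal.rpow_lt_top_of_nonneg h0 hC.ne, fun r hr f hf => ?_⟩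
  have hfm := hf.1.mono_ac hw.isWeight.absolutelyContinuous
  rw [hw.isWeight.eLpNorm_eq hp₁ hp hfm, hw.isWeight.eLpNorm_eq hp₁ hp
    (hw.continuous_ballAverage hμ hμc hp₁ hp hf hr).aestronglyMeasurable,
    ← ENNReal.mul_rpow_of_nonneg _ _ h0]
  refine ENNReal.rpow_le_rpow ((lintegral_mono fun x => ?_).trans (H r hr _ hfm.enorm)) h0
  dsimp only
  gcongr
  exact hμ.enorm_ballAverage_le f x hr

end

theorem eLpNorm_restrict_le_of_norm_le {𝕜 : Type*} [RCLike 𝕜] {X : Type*} [MeasurableSpace X]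
    {p : ℝ≥0∞} {s : Set X} {ν : Measure X} {u : X → 𝕜} {η : ℝ}
    (hs : MeasurableSet s) (h : ∀ x ∈ s, ‖u x‖ ≤ η) :
    eLpNorm u p (ν.restrict s) ≤ ν s ^ p.toReal⁻¹ * ENNReal.ofReal η := by
  have := eLpNorm_le_of_ae_bound (p := p) ((ae_restrict_iff' hs).2 (ae_of_all ν h))
  rwa [Measure.restrict_apply_univ] at this

theorem exists_pos_mul_ofReal_le {c ε : ℝ≥0∞} (hc : c ≠ ∞) (hε : 0 < ε) :
    ∃ η : ℝ, 0 < η ∧ c * ENNReal.ofReal η ≤ ε := by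
  have h : Tendsto (fun η : ℝ => c * ENNReal.ofReal η) (𝓝[>] 0) (𝓝 0) := by
    have := ENNReal.Tendsto.const_mul (a := c)
      ((ENNReal.continuous_ofReal.tendsto 0).mono_left (nhdsWithin_le_nhds (s := Set.Ioi 0))) (Or.inr hc)
    simpa using this
  obtain ⟨η, h1, h2⟩ := ((ENNReal.tendsto_nhds_zero.1 h ε hε).and self_mem_nhdsWithin).exists
  exact ⟨η, h2, h1⟩

/-! ### Convergence for a single function -/

section

variable {𝕜 : Type*} [RCLike 𝕜] {X : Type*} [MetricSpace X] [MeasurableSpace X] [BorelSpace X]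
  {μ : Measure X} {p : ℝ≥0∞} {w : X → ℝ≥0∞} {f g : X → 𝕜}

theorem IsMuckenhoupt.isLocallyFiniteMeasure {p : ℝ} (hμ : IsHomogeneousType μ)
    (hw : IsMuckenhoupt μ p w) (hp : 1 < p) : IsLocallyFiniteMeasure (μ.withDensity w) :=
  isLocallyFiniteMeasure_of_ball_lt_top fun x r hr => by
    rw [withDensity_apply _ measurableSet_ball]
    exact (hw.setLIntegral_lt_top hμ hp x hr).1

/-- Uniform continuity makes the difference uniformly small, and for r < 1 it vanishes off the
compact 1-thickening of the support. -/
theorem IsHomogeneousType.tendsto_eLpNorm_sub_ballAverage_of_hasCompactSupport [ProperSpace X]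
    (hμ : IsHomogeneousType μ) {ν : Measure X} [IsLocallyFiniteMeasure ν]
    (hg : Continuous g) (hgs : HasCompactSupport g) :
    Tendsto (fun r : ℝ => eLpNorm (g - ballAverage μ r g) p ν) (𝓝[>] 0) (𝓝 0) := by
  have := isLocallyFiniteMeasure_of_ball_lt_top hμ.ball_lt_top
  have hZ : IsCompact (cthickening 1 (tsupport g)) := hgs.isCompact.cthickening
  set Z := cthickening 1 (tsupport g)
  refine ENNReal.tendsto_nhds_zero.2 fun ε hε => ?_
  obtain ⟨η, hη, hηε⟩ := exists_pos_mul_ofReal_le (c := ν Z ^ p.toReal⁻¹)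
    (ENNReal.rpow_lt_top_of_nonneg (by positivity) hZ.measure_lt_top.ne).ne hε
  obtain ⟨δ, hδ, hgδ⟩ := Metric.uniformContinuous_iff.1
    (hgs.uniformContinuous_of_continuous hg) η hη
  have hr : ∀ᶠ r : ℝ in 𝓝[>] 0, r < min δ 1 :=
    nhdsWithin_le_nhds (Iio_mem_nhds (lt_min hδ one_pos))
  filter_upwards [hr, self_mem_nhdsWithin] with r hr hr0
  rw [Set.mem_Ioi] at hr0
  refine le_trans ?_ hηε
  rw [← eLpNorm_restrict_eq_of_support_subset (s := Z)]
  · refine eLpNorm_restrict_le_of_norm_le hZ.measurableSet fun x _ => ?_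
    rw [Pi.sub_apply, ← dist_eq_norm, dist_comm, ← mem_closedBall]
    refine (convex_closedBall (g x) η).set_average_mem isClosed_closedBall
      (hμ.ball_pos x r hr0).ne' (hμ.ball_lt_top x r hr0).ne ?_
      (hg.integrable_of_hasCompactSupport hgs).integrableOn
    refine (ae_restrict_iff' measurableSet_ball).2 (ae_of_all _ fun y hy => ?_)
    exact (hgδ (lt_of_lt_of_le (mem_ball.1 hy) (hr.le.trans (min_le_left _ _)))).le
  · intro x hx
    by_contra hxZ
    refine hx ?_
    have hgy : ∀ y ∈ closedBall x 1, g y = 0 := fun y hy => by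
      by_contra hne
      exact hxZ (mem_cthickening_of_dist_le x y 1 _ (subset_tsupport _ hne)
        (mem_closedBall'.1 hy))
    rw [Pi.sub_apply, hgy x (mem_closedBall_self zero_le_one), ballAverage, setAverage_eq,
      setIntegral_eq_zero_of_forall_eq_zero fun y hy => hgy y ?_]
    · simp
    · exact ball_subset_closedBall.trans
        (closedBall_subset_closedBall (hr.le.trans (min_le_right _ _))) hy

/-- The operator 1 - T_r is linear and bounded uniformly in r. This serves both the density argument
and the passage to totally bounded sets. -/
theorem IsMuckenhoupt.exists_eLpNorm_sub_ballAverage_le [SecondCountableTopology X] (𝕜 : Type*)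
    [RCLike 𝕜] (hμ : IsHomogeneousType μ) (hμc : IsMetricallyContinuous μ)
    (hw : IsMuckenhoupt μ p.toReal w) (hp₁ : 1 < p) (hp : p < ∞) :
    ∃ C : ℝ≥0∞, C ≠ ∞ ∧ ∀ r : ℝ, 0 < r → ∀ f g : X → 𝕜, MemLp f p (μ.withDensity w) →
      MemLp g p (μ.withDensity w) →
      eLpNorm (f - ballAverage μ r f) p (μ.withDensity w) ≤
        eLpNorm (g - ballAverage μ r g) p (μ.withDensity w) +
          C * eLpNorm (f - g) p (μ.withDensity w) := by
  obtain ⟨C, hC, hCf⟩ := hw.exists_eLpNorm_ballAverage_le 𝕜 hμ hμc hp₁ hp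
  refine ⟨1 + C, by finiteness, fun r hr f g hf hg => ?_⟩
  have hT : ∀ u : X → 𝕜, MemLp u p (μ.withDensity w) →
      AEStronglyMeasurable (ballAverage μ r u) (μ.withDensity w) := fun u hu =>
    (hw.continuous_ballAverage hμ hμc hp₁ hp hu hr).aestronglyMeasurable
  have hfg := hf.sub hg
  have e : f - ballAverage μ r f = (g - ballAverage μ r g) + ((f - g) - ballAverage μ r (f - g)) := by
    rw [ballAverage_sub (fun x => hw.integrableOn_ball hμ hp₁ hp hf x hr)
      (fun x => hw.integrableOn_ball hμ hp₁ hp hg x hr)]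
    abel
  rw [e, add_mul, one_mul]
  refine (eLpNorm_add_le (hg.1.sub (hT g hg)) (hfg.1.sub (hT _ hfg)) hp₁.le).trans ?_
  gcongr
  exact (eLpNorm_sub_le hfg.1 (hT _ hfg) hp₁.le).trans (by gcongr; exact hCf r hr _ hfg)

theorem IsMuckenhoupt.tendsto_eLpNorm_sub_ballAverage [ProperSpace X] (hμ : IsHomogeneousType μ)
    (hμc : IsMetricallyContinuous μ) (hw : IsMuckenhoupt μ p.toReal w) (hp₁ : 1 < p) (hp : p < ∞)
    (hf : MemLp f p (μ.withDensity w)) :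
    Tendsto (fun r : ℝ => eLpNorm (f - ballAverage μ r f) p (μ.withDensity w))
      (𝓝[>] 0) (𝓝 0) := by
  have := hw.isLocallyFiniteMeasure hμ (one_lt_toReal hp₁ hp)
  obtain ⟨C, hC, hCf⟩ := hw.exists_eLpNorm_sub_ballAverage_le 𝕜 hμ hμc hp₁ hp
  refine ENNReal.tendsto_nhds_zero.2 fun ε hε => ?_
  obtain ⟨δ, hδ, hCδ⟩ := exists_pos_mul_ofReal_le hC (ENNReal.half_pos hε.ne')
  obtain ⟨g, hgs, hgf, hgc, hg⟩ :=
    hf.exists_hasCompactSupport_eLpNorm_sub_le hp.ne (ENNReal.ofReal_pos.2 hδ).ne'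
  have hg0 := hμ.tendsto_eLpNorm_sub_ballAverage_of_hasCompactSupport (p := p)
    (ν := μ.withDensity w) hgc hgs
  filter_upwards [ENNReal.tendsto_nhds_zero.1 hg0 (ε / 2) (ENNReal.half_pos hε.ne'),
    self_mem_nhdsWithin] with r hr hr0
  calc eLpNorm (f - ballAverage μ r f) p (μ.withDensity w)
      ≤ _ := hCf r hr0 f g hf hg
    _ ≤ ε / 2 + C * ENNReal.ofReal δ := by gcongr
    _ ≤ ε / 2 + ε / 2 := by gcongr
    _ = ε := ENNReal.add_halves ε

theorem tendsto_eLpNorm_indicator_compl_ball [ProperSpace X] {ν : Measure X}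
    [IsLocallyFiniteMeasure ν] (hp : p ≠ ∞) (hf : MemLp f p ν) (x₀ : X) :
    Tendsto (fun A : ℝ => eLpNorm ((ball x₀ A)ᶜ.indicator f) p ν) atTop (𝓝 0) := by
  refine ENNReal.tendsto_nhds_zero.2 fun ε hε => ?_
  obtain ⟨g, hgs, hgf, -, -⟩ := hf.exists_hasCompactSupport_eLpNorm_sub_le hp hε.ne'
  obtain ⟨R, hR⟩ := hgs.isCompact.isBounded.subset_ball x₀
  filter_upwards [eventually_ge_atTop R] with A hA
  have e : (ball x₀ A)ᶜ.indicator f = (ball x₀ A)ᶜ.indicator (f - g) := by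
    refine Set.indicator_congr fun x hx => ?_
    have : g x = 0 := image_eq_zero_of_notMem_tsupport fun h =>
      hx (ball_subset_ball hA (hR h))
    simp [this]
  rw [e]
  exact (eLpNorm_indicator_le _).trans hgf

end

/-! ### Total boundedness in metric spaces -/

section

variable {α : Type*} [PseudoMetricSpace α] {s : Set α}

/-- A finite net reduces the supremum to finitely many pointwise limits, and the Lipschitz bound
covers the remaining points. -/
theorem TotallyBounded.tendsto_iSup {ι : Type*} {l : Filter ι} {φ : ι → α → ℝ≥0∞} {M : ℝ≥0∞}
    (hs : TotallyBounded s) (hM : M ≠ ∞)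
    (hφ : ∀ᶠ i in l, ∀ x y, φ i x ≤ φ i y + M * edist x y)
    (h0 : ∀ x, Tendsto (φ · x) l (𝓝 0)) :
    Tendsto (fun i => ⨆ x ∈ s, φ i x) l (𝓝 0) := by
  refine ENNReal.tendsto_nhds_zero.2 fun ε hε => ?_
  -- Using 1 + M instead of M avoids division by zero.
  have hM1 : 1 + M ≠ ∞ := by finiteness
  have hM0 : 1 + M ≠ 0 := by simp
  have hδ : 0 < ε / 2 / (1 + M) := ENNReal.div_pos (ENNReal.half_pos hε.ne').ne' hM1
  obtain ⟨t, ht, hst⟩ := EMetric.totallyBounded_iff.1 hs _ hδ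
  have ht0 : ∀ᶠ i in l, ∀ y ∈ t, φ i y ≤ ε / 2 := (eventually_all_finite ht).2 fun y _ =>
    ENNReal.tendsto_nhds_zero.1 (h0 y) _ (ENNReal.half_pos hε.ne')
  filter_upwards [hφ, ht0] with i h1 h2
  refine iSup₂_le fun x hx => ?_
  obtain ⟨y, hy, hxy⟩ := Set.mem_iUnion₂.1 (hst hx)
  calc φ i x ≤ φ i y + M * edist x y := h1 x y
    _ ≤ ε / 2 + (1 + M) * (ε / 2 / (1 + M)) := by
        gcongr
        · exact h2 y hy
        · exact le_add_self
        · exact (Metric.mem_eball.1 hxy).le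
    _ = ε := by rw [ENNReal.mul_div_cancel hM0 hM1, ENNReal.add_halves]

/-- The net of the image is taken inside the image, so its centres lift to points of `s`, where `h`
applies. -/
theorem exists_finite_cover_of_totallyBounded_image {β : Type*} [PseudoMetricSpace β] {Φ : α → β}
    {ε δ : ℝ} (hδ : 0 < δ) (hΦ : TotallyBounded (Φ '' s))
    (h : ∀ x ∈ s, ∀ y ∈ s, dist (Φ x) (Φ y) < δ → dist x y < ε) :
    ∃ t : Set α, t.Finite ∧ s ⊆ ⋃ y ∈ t, ball y ε := by
  obtain ⟨u, hus, hu, hsu⟩ := Metric.finite_approx_of_totallyBounded hΦ δ hδ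
  obtain ⟨t, hts, ht, rfl⟩ := Set.exists_subset_image_finite_and.1 ⟨u, hus, hu, rfl⟩
  refine ⟨t, ht, fun x hx => ?_⟩
  obtain ⟨z, hz, hxz⟩ := Set.mem_iUnion₂.1 (hsu (Set.mem_image_of_mem Φ hx))
  obtain ⟨y, hy, rfl⟩ := hz
  exact Set.mem_biUnion hy (h x hx y (hts hy) hxz)

end

theorem IsMuckenhoupt.exists_norm_ballAverage_le (𝕜 : Type*) [RCLike 𝕜]
    {X : Type*} [MetricSpace X] [MeasurableSpace X] {μ : Measure X} {p : ℝ≥0∞} {w : X → ℝ≥0∞}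
    (hμ : IsHomogeneousType μ) (hw : IsMuckenhoupt μ p.toReal w)
    (hp₁ : 1 < p) (hp : p < ∞) {M : ℝ≥0∞} (hM : M ≠ ∞) {r : ℝ} (hr : 0 < r) (x : X) :
    ∃ R : ℝ, ∀ f : X → 𝕜, MemLp f p (μ.withDensity w) →
      eLpNorm f p (μ.withDensity w) ≤ M → ‖ballAverage μ r f x‖ ≤ R := by
  have h1 := one_lt_toReal hp₁ hp
  have hθ : 0 ≤ 1 - 1 / p.toReal := by
    have : 1 / p.toReal ≤ 1 := by rw [div_le_one (by linarith)]; exact h1.le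
    linarith
  have hS := ENNReal.rpow_lt_top_of_nonneg hθ (hw.setLIntegral_lt_top hμ h1 x hr).2.ne
  set S := (∫⁻ z in ball x r, dualWeight p.toReal w z ∂μ) ^ (1 - 1 / p.toReal)
  have hfin : (μ (ball x r))⁻¹ * (M * S) ≠ ∞ := ENNReal.mul_ne_top
    (ENNReal.inv_ne_top.2 (hμ.ball_pos x r hr).ne') (ENNReal.mul_ne_top hM hS.ne)
  refine ⟨((μ (ball x r))⁻¹ * (M * S)).toReal, fun f hf hfM => ?_⟩
  rw [← toReal_enorm]
  refine ENNReal.toReal_mono hfin ((hμ.enorm_ballAverage_le f x hr).trans ?_)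
  gcongr
  refine (hw.isWeight.setLIntegral_enorm_le hp₁ hp
    (hf.1.mono_ac hw.isWeight.absolutelyContinuous) _).trans ?_
  gcongr

/-- Off `s` only the tails matter; on `s` the comparison passes through `u` and `v`. -/
theorem eLpNorm_sub_le_of_indicator_compl {𝕜 : Type*} [RCLike 𝕜] {X : Type*} [MeasurableSpace X]
    {p : ℝ≥0∞} {f g : X → 𝕜} {ν : Measure X} {s : Set X} (hs : MeasurableSet s)
    (hp : 1 ≤ p) {u v : X → 𝕜} (hf : AEStronglyMeasurable f ν) (hg : AEStronglyMeasurable g ν)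
    (hu : AEStronglyMeasurable u ν) (hv : AEStronglyMeasurable v ν) {η : ℝ}
    (h : ∀ x ∈ s, ‖u x - v x‖ ≤ η) :
    eLpNorm (f - g) p ν ≤ eLpNorm (sᶜ.indicator f) p ν + eLpNorm (sᶜ.indicator g) p ν +
      (eLpNorm (f - u) p ν + eLpNorm (g - v) p ν + ν s ^ p.toReal⁻¹ * ENNReal.ofReal η) := by
  have e : f - g = sᶜ.indicator (f - g) + s.indicator (f - g) :=
    (Set.indicator_compl_add_self s (f - g)).symm
  have e' : f - g = (f - u) - (g - v) + (u - v) := by abel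
  have h1 : eLpNorm (sᶜ.indicator (f - g)) p ν ≤
      eLpNorm (sᶜ.indicator f) p ν + eLpNorm (sᶜ.indicator g) p ν := by
    rw [Set.indicator_sub']
    exact eLpNorm_sub_le (hf.indicator hs.compl) (hg.indicator hs.compl) hp
  have h2 : eLpNorm (s.indicator (f - g)) p ν ≤
      eLpNorm (f - u) p ν + eLpNorm (g - v) p ν + ν s ^ p.toReal⁻¹ * ENNReal.ofReal η := by
    rw [eLpNorm_indicator_eq_eLpNorm_restrict hs, e']
    refine (eLpNorm_add_le ((hf.sub hu).sub (hg.sub hv)).restrict (hu.sub hv).restrict hp).trans ?_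
    refine add_le_add ?_ (eLpNorm_restrict_le_of_norm_le hs h)
    exact (eLpNorm_mono_measure _ Measure.restrict_le_self).trans
      (eLpNorm_sub_le (hf.sub hu) (hg.sub hv) hp)
  calc eLpNorm (f - g) p ν ≤ _ := by
        conv_lhs => rw [e]
        exact eLpNorm_add_le ((hf.sub hg).indicator hs.compl) ((hf.sub hg).indicator hs) hp
    _ ≤ _ := add_le_add h1 h2

/-! ### The two implications -/

section

variable {𝕜 : Type*} [RCLike 𝕜] {X : Type*} [MetricSpace X] [MeasurableSpace X] [BorelSpace X]
  {μ : Measure X} {p : ℝ≥0∞} {w : X → ℝ≥0∞} {f g : X → 𝕜}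

/-- Averages over balls of radius `r` of functions in a bounded subset of the weighted `L^p` space
are, on a compact set, uniformly determined by their values at finitely many points. -/
theorem IsMuckenhoupt.exists_finset_norm_ballAverage_sub_lt (𝕜 : Type*) [RCLike 𝕜]
    (hμ : IsHomogeneousType μ) (hμc : IsMetricallyContinuous μ) (hw : IsMuckenhoupt μ p.toReal w)
    (hp₁ : 1 < p) (hp : p < ∞) {M : ℝ≥0∞} (hM : M ≠ ∞) {r : ℝ} (hr : 0 < r) {Z : Set X}
    (hZ : IsCompact Z) {η : ℝ} (hη : 0 < η) :
    ∃ t : Finset X, ∀ y ∈ Z, ∃ x ∈ t, ∀ f : X → 𝕜, MemLp f p (μ.withDensity w) →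
      eLpNorm f p (μ.withDensity w) ≤ M → ‖ballAverage μ r f x - ballAverage μ r f y‖ < η := by
  have h : ∀ x ∈ Z, {y | M * ballAverageModulus μ p.toReal w r x y < ENNReal.ofReal η} ∈ 𝓝 x := by
    intro x _
    have h := ENNReal.Tendsto.const_mul (a := M)
      (hw.tendsto_ballAverageModulus hμ hμc (one_lt_toReal hp₁ hp) hr x) (Or.inr hM)
    rw [mul_zero] at h
    exact h.eventually (gt_mem_nhds (ENNReal.ofReal_pos.2 hη))
  obtain ⟨t, -, ht⟩ := hZ.elim_nhds_subcover _ h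
  refine ⟨t, fun y hy => ?_⟩
  obtain ⟨x, hx, hxy⟩ := Set.mem_iUnion₂.1 (ht hy)
  refine ⟨x, hx, fun f hf hfM => ?_⟩
  rw [← ENNReal.ofReal_lt_ofReal_iff hη, ofReal_norm]
  refine lt_of_le_of_lt (hw.enorm_ballAverage_sub_le hμ hp₁ hp hf hr x y) (lt_of_le_of_lt ?_ hxy)
  gcongr

theorem IsMuckenhoupt.totallyBounded_of_tendsto [ProperSpace X] [Fact (1 ≤ p)]
    (hμ : IsHomogeneousType μ) (hμc : IsMetricallyContinuous μ) (hw : IsMuckenhoupt μ p.toReal w)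
    (hp₁ : 1 < p) (hp : p < ∞) (x₀ : X) {K : Set (Lp 𝕜 p (μ.withDensity w))}
    (ha : (⨆ f ∈ K, eLpNorm f p (μ.withDensity w)) < ∞)
    (hb : Tendsto (fun A : ℝ => ⨆ f ∈ K, eLpNorm ((ball x₀ A)ᶜ.indicator f) p (μ.withDensity w))
      atTop (𝓝 0))
    (hc : Tendsto (fun r : ℝ => ⨆ f ∈ K, eLpNorm (f - ballAverage μ r f : X → 𝕜) p (μ.withDensity w))
      (𝓝[>] 0) (𝓝 0)) : TotallyBounded K := by
  have := hw.isLocallyFiniteMeasure hμ (one_lt_toReal hp₁ hp)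
  refine Metric.totallyBounded_iff.2 fun ε hε => ?_
  -- Five errors arise: two tails, two averaging errors and one comparison on the ball. Their sum
  -- 5ε/6 is strictly below ε.
  have he : 0 < ENNReal.ofReal (ε / 6) := ENNReal.ofReal_pos.2 (by positivity)
  obtain ⟨A, hA⟩ := (ENNReal.tendsto_nhds_zero.1 hb _ he).exists
  obtain ⟨r, hr, hr0⟩ :=
    ((ENNReal.tendsto_nhds_zero.1 hc _ he).and self_mem_nhdsWithin).exists
  replace hA : ∀ f ∈ K, eLpNorm ((ball x₀ A)ᶜ.indicator f) p (μ.withDensity w) ≤ ENNReal.ofReal (ε / 6) :=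
    iSup₂_le_iff.1 hA
  replace hr : ∀ f ∈ K, eLpNorm (f - ballAverage μ r f : X → 𝕜) p (μ.withDensity w) ≤ ENNReal.ofReal (ε / 6) :=
    iSup₂_le_iff.1 hr
  set M := ⨆ f ∈ K, eLpNorm f p (μ.withDensity w)
  have hfM : ∀ f ∈ K, eLpNorm f p (μ.withDensity w) ≤ M := fun f hf => le_iSup₂_of_le f hf le_rfl
  obtain ⟨η, hη, hηε⟩ := exists_pos_mul_ofReal_le (c := (μ.withDensity w) (ball x₀ A) ^ p.toReal⁻¹)
    (ENNReal.rpow_lt_top_of_nonneg (by positivity) measure_ball_lt_top.ne).ne he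
  -- One third each for moving f from y to a node, exchanging f for g there, and moving g back to y.
  have hη3 : 0 < η / 3 := by positivity
  obtain ⟨t, ht⟩ := hw.exists_finset_norm_ballAverage_sub_lt 𝕜 hμ hμc hp₁ hp ha.ne hr0
    (isCompact_closedBall x₀ A) hη3
  choose R hR using fun x => hw.exists_norm_ballAverage_le 𝕜 hμ hp₁ hp ha.ne hr0 x
  -- Sampling the averages at the nodes maps `K` into a finite product of compact balls of `𝕜`.
  refine exists_finite_cover_of_totallyBounded_image
    (Φ := fun (f : Lp 𝕜 p (μ.withDensity w)) (x : t) => ballAverage μ r f x) hη3 ?_ ?_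
  · refine ((isCompact_univ_pi fun x : t =>
      isCompact_closedBall (0 : 𝕜) (R x)).totallyBounded).subset ?_
    rintro _ ⟨f, hf, rfl⟩ x -
    exact mem_closedBall_zero_iff.2 (hR x f (Lp.memLp f) (hfM f hf))
  · intro f hf g hg hfg
    rw [dist_pi_lt_iff hη3] at hfg
    have hT : ∀ u : Lp 𝕜 p (μ.withDensity w), AEStronglyMeasurable (ballAverage μ r u) (μ.withDensity w) := fun u =>
      (hw.continuous_ballAverage hμ hμc hp₁ hp (Lp.memLp u) hr0).aestronglyMeasurable
    have hclose : ∀ y ∈ ball x₀ A, ‖ballAverage μ r f y - ballAverage μ r g y‖ ≤ η := by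
      intro y hy
      obtain ⟨x, hx, hxy⟩ := ht y (ball_subset_closedBall hy)
      have h1 := hxy f (Lp.memLp f) (hfM f hf)
      have h2 := hxy g (Lp.memLp g) (hfM g hg)
      have h3 := hfg ⟨x, hx⟩
      rw [← dist_eq_norm] at h1 h2 ⊢
      rw [dist_comm] at h1
      have := dist_triangle4 (ballAverage μ r f y) (ballAverage μ r f x) (ballAverage μ r g x)
        (ballAverage μ r g y)
      linarith
    rw [← ENNReal.ofReal_lt_ofReal_iff hε, ← edist_dist, Lp.edist_def]
    calc eLpNorm (f - g : X → 𝕜) p (μ.withDensity w)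
        ≤ _ := eLpNorm_sub_le_of_indicator_compl measurableSet_ball hp₁.le
          (Lp.aestronglyMeasurable f) (Lp.aestronglyMeasurable g) (hT f) (hT g) hclose
      _ ≤ ENNReal.ofReal (ε / 6) + ENNReal.ofReal (ε / 6) +
          (ENNReal.ofReal (ε / 6) + ENNReal.ofReal (ε / 6) + ENNReal.ofReal (ε / 6)) := by
        exact add_le_add (add_le_add (hA f hf) (hA g hg))
          (add_le_add (add_le_add (hr f hf) (hr g hg)) hηε)
      _ = ENNReal.ofReal (5 * (ε / 6)) := by
        have : 0 ≤ ε / 6 := by positivity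
        repeat rw [← ENNReal.ofReal_add (by positivity) (by positivity)]
        congr 1
        ring
      _ < ENNReal.ofReal ε := (ENNReal.ofReal_lt_ofReal_iff hε).2 (by linarith)

/-- The Lipschitz constants are 1 for the tails and the uniform operator bound `C` for the averaging
error. -/
theorem IsMuckenhoupt.tendsto_of_totallyBounded [ProperSpace X] [Fact (1 ≤ p)]
    (hμ : IsHomogeneousType μ) (hμc : IsMetricallyContinuous μ) (hw : IsMuckenhoupt μ p.toReal w)
    (hp₁ : 1 < p) (hp : p < ∞) (x₀ : X) {K : Set (Lp 𝕜 p (μ.withDensity w))}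
    (hK : TotallyBounded K) :
    (⨆ f ∈ K, eLpNorm f p (μ.withDensity w)) < ∞ ∧
      Tendsto (fun A : ℝ => ⨆ f ∈ K, eLpNorm ((ball x₀ A)ᶜ.indicator f) p (μ.withDensity w))
        atTop (𝓝 0) ∧
      Tendsto (fun r : ℝ => ⨆ f ∈ K, eLpNorm (f - ballAverage μ r f : X → 𝕜) p (μ.withDensity w))
        (𝓝[>] 0) (𝓝 0) := by
  have := hw.isLocallyFiniteMeasure hμ (one_lt_toReal hp₁ hp)
  refine ⟨?_, hK.tendsto_iSup ENNReal.one_ne_top (Eventually.of_forall fun A f g => ?_)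
    fun f => tendsto_eLpNorm_indicator_compl_ball hp.ne (Lp.memLp f) x₀, ?_⟩
  · obtain ⟨R, hR⟩ := hK.isBounded.subset_closedBall 0
    refine (iSup₂_le fun f hf => ?_).trans_lt (ENNReal.ofReal_lt_top (r := R))
    rw [← Lp.enorm_def, ← ofReal_norm]
    exact ENNReal.ofReal_le_ofReal (mem_closedBall_zero_iff.1 (hR hf))
  · have e : (ball x₀ A)ᶜ.indicator (f : X → 𝕜) =
        (ball x₀ A)ᶜ.indicator g + (ball x₀ A)ᶜ.indicator (f - g : X → 𝕜) := by
      rw [← Set.indicator_add', add_sub_cancel]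
    have hs : MeasurableSet (ball x₀ A)ᶜ := measurableSet_ball.compl
    rw [e, one_mul, Lp.edist_def]
    refine (eLpNorm_add_le ((Lp.aestronglyMeasurable g).indicator hs)
      (((Lp.aestronglyMeasurable f).sub (Lp.aestronglyMeasurable g)).indicator hs) hp₁.le).trans ?_
    gcongr
    exact eLpNorm_indicator_le _
  · obtain ⟨C, hC, hCf⟩ := hw.exists_eLpNorm_sub_ballAverage_le 𝕜 hμ hμc hp₁ hp
    refine hK.tendsto_iSup hC ?_
      fun f => hw.tendsto_eLpNorm_sub_ballAverage hμ hμc hp₁ hp (Lp.memLp f)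
    filter_upwards [self_mem_nhdsWithin] with r hr f g
    rw [Lp.edist_def]
    exact hCf r hr f g (Lp.memLp f) (Lp.memLp g)

end

theorem theorem1p9 {𝕜 : Type*} [RCLike 𝕜]
    {X : Type*} [MetricSpace X] [CompleteSpace X] [MeasurableSpace X] [BorelSpace X]
    (μ : Measure X) (hμ : IsHomogeneousType μ) (hμc : IsMetricallyContinuous μ)
    (x₀ : X) (p : ℝ≥0∞) [Fact (1 ≤ p)] (hp₁ : 1 < p) (hp : p < ∞)
    (w : X → ℝ≥0∞) (hw : IsMuckenhoupt μ p.toReal w)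
    (K : Set (Lp 𝕜 p (μ.withDensity w))) :
    IsCompact (closure K) ↔
      (⨆ f ∈ K, eLpNorm f p (μ.withDensity w)) < ∞ ∧
      Tendsto (fun A : ℝ => ⨆ f ∈ K, eLpNorm ((ball x₀ A)ᶜ.indicator f) p (μ.withDensity w))
        atTop (𝓝 0) ∧
      Tendsto (fun r : ℝ => ⨆ f ∈ K,
          eLpNorm (fun x => f x - ⨍ y in ball x r, f y ∂μ) p (μ.withDensity w))
        (𝓝[>] 0) (𝓝 0) := by
  have := hμ.properSpace
  constructor
  · intro h
    exact hw.tendsto_of_totallyBounded hμ hμc hp₁ hp x₀ (h.totallyBounded.subset subset_closure)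
  · rintro ⟨ha, hb, hc⟩
    exact isCompact_iff_totallyBounded_isComplete.2
      ⟨(hw.totallyBounded_of_tendsto hμ hμc hp₁ hp x₀ ha hb hc).closure, isClosed_closure.isComplete⟩
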